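/- Let $q$ be a prime power, let $t\ge 1$ and let $n_1,\dots,n_t,m_1,\dots,m_t\ge 1$ be integers with $n_i\le m_i$ for all $i$ and $m_1\ge\cdots\ge m_t$. Put $\Pi=\Pi_q(n_1\times m_1\mid\cdots\mid n_t\times m_t)=\bigoplus_{i=1}^t\mathbb F_q^{n_i\times m_i}$. A code is an $\mathbb F_q$-linear subspace $C\le\Pi$; its dual is $$C^\perp=\Big\{(Y_1,\dots,Y_t)\in\Pi \;\Big|\; \sum_{i=1}^t\operatorname{tr}(X_iY_i^{\top})=0\ \text{ for all }(X_1,\dots,X_t)\in C\Big\}.$$ For $\boldsymbol r\in\mathbb N_0^t$ and $r\in\mathbb N_0$ let $$W_{\boldsymbol r}(C)=|\{X\in C\mid \operatorname{rk}(X_i)=r_i\text{ for all }i\}|,\qquad W_r(C)=\Big|\Big\{X\in C\;\Big|\;\sum_{i=1}^t\operatorname{rk}(X_i)=r\Big\}\Big|$$ (the rank-list distribution and the sum-rank distribution of $C$). For $\boldsymbol v,\boldsymbol u\in\mathbb N_0^t$ write $\boldsymbol v\le\boldsymbol u$ if $v_i\le u_i$ for all $i$, and let $\begin{bmatrix}a\\b\end{bmatrix}_q=\prod_{j=0}^{b-1}\frac{q^a-q^j}{q^b-q^j}$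 for $a,b\in\mathbb N_0$ (so it is $0$ if $b>a$) denote the Gaussian binomial coefficient. (1) For every code $C\le\Pi$ and every $\boldsymbol u\in\mathbb N_0^t$, $$W_{\boldsymbol u}(C^\perp)=\frac1{|C|}\sum_{\boldsymbol h\in\mathbb N_0^t}W_{\boldsymbol h}(C)\sum_{\boldsymbol v\le\boldsymbol u}q^{\sum_{i=1}^t m_iv_i}\prod_{i=1}^t(-1)^{u_i-v_i}q^{\binom{u_i-v_i}{2}}\begin{bmatrix}n_i-h_i\\v_i\end{bmatrix}_q\begin{bmatrix}n_i-v_i\\u_i-v_i\end{bmatrix}_q .$$ Here $W_{\boldsymbol h}(C)\neq0$ for only finitely many $\boldsymbol h$. Terms with $W_{\boldsymbol h}(C)=0$ (in particular those with $h_i>n_i$ for some $i$) and terms with $v_i>n_i$ for some $i$ are read as $0$. In particular, the rank-list distribution of $C$ determines the rank-list distribution of $C^\perp$: if $C_1,C_2\le\Pi$ have $W_{\boldsymbol h}(C_1)=W_{\boldsymbol h}(C_2)$ for all $\boldsymbol h$, then $W_{\boldsymbol u}(C_1^\perp)=W_{\boldsymbol u}(C_2^\perp)$ for all $\boldsymbol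 u$. (2) The sum-rank distribution of a code does not, in general, determine that of its dual: in $\Pi_2(2\times2\mid2\times2)$ there are codes $C_1,C_2$ with $W_r(C_1)=W_r(C_2)$ for all $r\in\mathbb N_0$, but $W_r(C_1^\perp)\ne W_r(C_2^\perp)$ for some $r\in\mathbb N_0$. -/

import Mathlib

/-- The ambient space `Π_q(n₁ × m₁ ∣ ⋯ ∣ n_t × m_t)` of `t`-tuples of matrices over `F`, the `i`-th
block being an `n i × m i` matrix. A code is an `F`-linear subspace of it. -/
abbrev SumRankSpace (F : Type*) {t : ℕ} (n m : Fin t → ℕ) : Type _ :=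
  ∀ i : Fin t, Matrix (Fin (n i)) (Fin (m i)) F

namespace SumRankSpace

variable {F : Type*} [Field F] {t : ℕ} {n m : Fin t → ℕ}

/-- The sum-rank of a tuple of matrices. -/
noncomputable def srk (X : SumRankSpace F n m) : ℕ := ∑ i, (X i).rank

/-- The bilinear form `∑ i, ⟨X i, Y i⟩`, where `⟨A, B⟩ = tr (A Bᵀ)` is the trace product. -/
def traceProd (X Y : SumRankSpace F n m) : F := ∑ i, (X i * (Y i).transpose).trace

/-- The dual of a code with respect to the trace product. -/
def dual (C : Submodule F (SumRankSpace F n m)) : Submodule F (SumRankSpace F n m) where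
  carrier := {Y | ∀ X ∈ C, traceProd X Y = 0}
  zero_mem' := fun X _ => by simp [traceProd]
  add_mem' := fun {Y Z} hY hZ X hX => by
    have h1 : traceProd X Y = 0 := hY X hX
    have h2 : traceProd X Z = 0 := hZ X hX
    have h3 : traceProd X (Y + Z) = traceProd X Y + traceProd X Z := by
      simp [traceProd, Matrix.mul_add, Finset.sum_add_distrib]
    rw [h3, h1, h2, add_zero]
  smul_mem' := fun c Y hY X hX => by
    have h1 : traceProd X Y = 0 := hY X hX
    have h2 : traceProd X (c • Y) = c * traceProd X Y := by
      simp [traceProd, Finset.mul_sum]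
    rw [h2, h1, mul_zero]

/-- The sum-rank distribution: the number of codewords of sum-rank `r`. -/
noncomputable def sumRankDist (C : Submodule F (SumRankSpace F n m)) (r : ℕ) : ℕ :=
  Nat.card {X : SumRankSpace F n m // X ∈ C ∧ srk X = r}

/-- The rank-list distribution: the number of codewords whose `i`-th block has rank `r i`,
for all `i`. -/
noncomputable def rankListDist (C : Submodule F (SumRankSpace F n m)) (r : Fin t → ℕ) : ℕ :=
  Nat.card {X : SumRankSpace F n m // X ∈ C ∧ ∀ i, (X i).rank = r i}

end SumRankSpace

/-- The Gaussian binomial coefficient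
`[a choose b]_q = ∏_{j < b} (q ^ a - q ^ j) / (q ^ b - q ^ j)`, for an integer `q ≥ 2`.
The factor for `j = a` makes it `0` when `a < b`. -/
def gaussianBinom (q a b : ℕ) : ℚ :=
  ∏ j ∈ Finset.range b, ((q : ℚ) ^ a - (q : ℚ) ^ j) / ((q : ℚ) ^ b - (q : ℚ) ^ j)

/-! Fix a nontrivial additive character χ of F. For a fixed tuple X, the sum of χ(∑ tr(X_i Y_iᵀ))
over all Y with rank list u factors over the blocks, and each block sum depends only on rk X_i.
Summing over X ∈ C instead gives |C| times the indicator of Y ∈ C^⊥ (`sum_addChar_traceProd`).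
Counting both ways gives (1).

The block sum is found by Möbius inversion on subspaces. The Y with columns in W contribute q^(m dim
W) if W ≤ ker Xᵀ and 0 otherwise (`sum_addChar_trace_cols_le`). Summing over k-dimensional W,
represented by ordered bases so that only tuples are counted, gives a triangular system in the rank
of Y (`sum_gaussianBinom_mul_rankCharSum`), solved by `gaussianBinom_inversion`.

For (2), two lines over 𝔽₂ are spanned by words of sum-rank 2 with rank lists (2,0) and (1,1); their
duals differ in the number of words of sum-rank 1. -/

/-! ### Gaussian binomials and their inversion formula -/

/-- The product `∏_{j < b} (q ^ a - q ^ j)`, which counts the linearly independent `b`-tuples in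
an `a`-dimensional space over a field with `q` elements. -/
def qFalling (q a b : ℕ) : ℚ :=
  ∏ j ∈ Finset.range b, ((q : ℚ) ^ a - (q : ℚ) ^ j)

theorem gaussianBinom_eq_div (q a b : ℕ) :
    gaussianBinom q a b = qFalling q a b / qFalling q b b := by
  simp [gaussianBinom, qFalling, Finset.prod_div_distrib]

theorem qFalling_eq_zero {q a b : ℕ} (h : a < b) : qFalling q a b = 0 :=
  Finset.prod_eq_zero (Finset.mem_range.2 h) (sub_self _)

theorem gaussianBinom_eq_zero {q a b : ℕ} (h : a < b) : gaussianBinom q a b = 0 := by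
  rw [gaussianBinom_eq_div, qFalling_eq_zero h, zero_div]

@[simp] theorem gaussianBinom_zero_right (q a : ℕ) : gaussianBinom q a 0 = 1 := by
  simp [gaussianBinom]

theorem qFalling_ne_zero {q a b : ℕ} (hq : 2 ≤ q) (h : b ≤ a) : qFalling q a b ≠ 0 := by
  refine Finset.prod_ne_zero_iff.2 fun j hj => sub_ne_zero.2 fun h' => ?_
  have h1 : q ^ a = q ^ j := by exact_mod_cast h'
  have h2 := Nat.pow_right_injective hq h1
  have := Finset.mem_range.1 hj
  omega

@[simp] theorem gaussianBinom_self {q : ℕ} (hq : 2 ≤ q) (a : ℕ) : gaussianBinom q a a = 1 := by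
  rw [gaussianBinom_eq_div, div_self (qFalling_ne_zero hq le_rfl)]

theorem qFalling_add (q b c d : ℕ) :
    qFalling q (b + d) (b + c) = qFalling q (b + d) b * ((q : ℚ) ^ (b * c) * qFalling q d c) := by
  unfold qFalling
  rw [Finset.prod_range_add]
  congr 1
  rw [pow_mul]
  have : ((q : ℚ) ^ b) ^ c = ∏ _j ∈ Finset.range c, (q : ℚ) ^ b := by simp
  rw [this, ← Finset.prod_mul_distrib]
  exact Finset.prod_congr rfl fun j _ => by ring

theorem qFalling_mul_qFalling {q n k u : ℕ} (hq : 2 ≤ q) (hn : u ≤ n) (hk : u ≤ k) :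
    qFalling q n k * qFalling q k u =
      qFalling q n u * (qFalling q k k * gaussianBinom q (n - u) (k - u)) := by
  obtain ⟨d, rfl⟩ := Nat.exists_eq_add_of_le hn
  obtain ⟨c, rfl⟩ := Nat.exists_eq_add_of_le hk
  have h := qFalling_ne_zero hq (le_refl c)
  simp only [Nat.add_sub_cancel_left, gaussianBinom_eq_div, qFalling_add]
  field_simp

theorem gaussianBinom_mul_gaussianBinom {q : ℕ} (hq : 2 ≤ q) (a b d : ℕ) :
    gaussianBinom q (a + d) a * gaussianBinom q d b =
      gaussianBinom q (a + d) (a + b) * gaussianBinom q (a + b) a := by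
  have h1 := qFalling_ne_zero hq (le_refl a)
  have h2 := qFalling_ne_zero hq (le_refl b)
  have h3 := qFalling_ne_zero hq (Nat.le_add_right a b)
  have h4 : (q : ℚ) ≠ 0 := by positivity
  simp only [gaussianBinom_eq_div, qFalling_add]
  field_simp

/-- The q-Pascal rule; it makes the alternating sum below telescope. -/
theorem gaussianBinom_succ_succ {q : ℕ} (hq : 2 ≤ q) {s j : ℕ} (hj : j ≤ s) :
    gaussianBinom q (s + 1) (j + 1) =
      (q : ℚ) ^ (s - j) * gaussianBinom q s j + gaussianBinom q s (j + 1) := by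
  obtain ⟨d, rfl⟩ := Nat.exists_eq_add_of_le hj
  have h1 := qFalling_ne_zero hq (le_refl j)
  have h2 := qFalling_ne_zero hq (Nat.succ_le_succ (Nat.zero_le j))
  have h4 : (q : ℚ) ≠ 0 := by positivity
  have e1 : qFalling q (j + 1) (j + 1) = ((q : ℚ) ^ (j + 1) - 1) * (q ^ j * qFalling q j j) := by
    have := qFalling_add q 1 j j
    simpa [add_comm 1, qFalling] using this
  have e2 : qFalling q (j + d + 1) (j + 1) =
      ((q : ℚ) ^ (j + d + 1) - 1) * (q ^ j * qFalling q (j + d) j) := by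
    have := qFalling_add q 1 j (j + d)
    simpa [add_comm 1, qFalling] using this
  have e3 : qFalling q (j + d) (j + 1) = qFalling q (j + d) j * ((q : ℚ) ^ (j + d) - q ^ j) := by
    simp [qFalling, Finset.prod_range_succ]
  have h5 : (q : ℚ) ^ (j + 1) - 1 ≠ 0 := by simpa [qFalling] using h2
  simp only [gaussianBinom_eq_div, e1, e2, e3, Nat.add_sub_cancel_left]
  field_simp
  ring

theorem sum_gaussianBinom_alternating {q : ℕ} (hq : 2 ≤ q) (s : ℕ) :
    ∑ j ∈ Finset.range (s + 1), (-1 : ℚ) ^ (s - j) * (q : ℚ) ^ ((s - j).choose 2) *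
      gaussianBinom q s j = if s = 0 then 1 else 0 := by
  cases s with
  | zero => simp
  | succ s =>
    -- Closed form of the partial sums. At k = s it equals -1, which cancels the last term j = s +
    -- 1.
    have key : ∀ k ≤ s, ∑ j ∈ Finset.range (k + 1), (-1 : ℚ) ^ (s + 1 - j) *
        (q : ℚ) ^ ((s + 1 - j).choose 2) * gaussianBinom q (s + 1) j =
        -((-1 : ℚ) ^ (s - k) * (q : ℚ) ^ ((s + 1 - k).choose 2) * gaussianBinom q s k) := by
      intro k hk
      induction k with
      | zero => simp [pow_succ]
      | succ k ih =>
        rw [Finset.sum_range_succ, ih (by omega), gaussianBinom_succ_succ hq (by omega)]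
        obtain ⟨d, rfl⟩ := Nat.exists_eq_add_of_le hk
        have e1 : k + 1 + d - k = d + 1 := by omega
        have e2 : k + 1 + d + 1 - k = d + 1 + 1 := by omega
        have e3 : k + 1 + d + 1 - (k + 1) = d + 1 := by omega
        have e4 : k + 1 + d - (k + 1) = d := by omega
        have e5 : (d + 1 + 1).choose 2 = d + 1 + (d + 1).choose 2 := by
          simp [Nat.choose_succ_succ' (d + 1) 1]
        rw [e1, e2, e3, e4, e5]
        ring
    rw [Finset.sum_range_succ, key s le_rfl]
    simp [gaussianBinom_self hq]

/-- The two triangular matrices are inverse: by `gaussianBinom_mul_gaussianBinom` an entry of their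
product is a Gaussian binomial times an alternating sum, which vanishes off the diagonal. -/
theorem gaussianBinom_inversion {q : ℕ} (hq : 2 ≤ q) {n : ℕ} {f g : ℕ → ℂ}
    (h : ∀ k ≤ n, ∑ u ∈ Finset.range (k + 1), (gaussianBinom q (n - u) (k - u) : ℂ) * f u = g k)
    {k : ℕ} (hk : k ≤ n) :
    f k = ∑ v ∈ Finset.range (k + 1), (-1 : ℂ) ^ (k - v) * (q : ℂ) ^ ((k - v).choose 2) *
      (gaussianBinom q (n - v) (k - v) : ℂ) * g v := by
  have e : ∀ v ∈ Finset.range (k + 1), (-1 : ℂ) ^ (k - v) * (q : ℂ) ^ ((k - v).choose 2) *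
      (gaussianBinom q (n - v) (k - v) : ℂ) * g v =
      ∑ w ∈ Finset.range (v + 1), (((-1 : ℚ) ^ (k - v) * (q : ℚ) ^ ((k - v).choose 2) *
        (gaussianBinom q (n - v) (k - v) * gaussianBinom q (n - w) (v - w)) : ℚ) : ℂ) * f w := by
    intro v hv
    rw [← h v (by have := Finset.mem_range.1 hv; omega), Finset.mul_sum]
    refine Finset.sum_congr rfl fun w _ => ?_
    push_cast
    ring
  rw [Finset.sum_congr rfl e, Finset.sum_comm' (t' := Finset.range (k + 1))
    (s' := fun w => Finset.Ico w (k + 1)) (by simp; omega)]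
  have e' : ∀ w ∈ Finset.range (k + 1), ∑ v ∈ Finset.Ico w (k + 1),
      (((-1 : ℚ) ^ (k - v) * (q : ℚ) ^ ((k - v).choose 2) *
        (gaussianBinom q (n - v) (k - v) * gaussianBinom q (n - w) (v - w)) : ℚ) : ℂ) * f w =
      if w = k then f w else 0 := by
    intro w hw
    have hw : w ≤ k := by simpa [Nat.lt_succ_iff] using hw
    obtain ⟨s, rfl⟩ := Nat.exists_eq_add_of_le hw
    obtain ⟨r, rfl⟩ := Nat.exists_eq_add_of_le hk
    have e2 : w + s + 1 - w = s + 1 := by omega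
    rw [← Finset.sum_mul, ← Rat.cast_sum, Finset.sum_Ico_eq_sum_range, e2]
    have e3 : ∀ j ∈ Finset.range (s + 1), (-1 : ℚ) ^ (w + s - (w + j)) *
        (q : ℚ) ^ ((w + s - (w + j)).choose 2) *
        (gaussianBinom q (w + s + r - (w + j)) (w + s - (w + j)) *
          gaussianBinom q (w + s + r - w) (w + j - w)) =
        gaussianBinom q (s + r) s * ((-1 : ℚ) ^ (s - j) * (q : ℚ) ^ ((s - j).choose 2) *
          gaussianBinom q s j) := by
      intro j hj
      have hj : j ≤ s := by simpa [Nat.lt_succ_iff] using hj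
      obtain ⟨b, rfl⟩ := Nat.exists_eq_add_of_le hj
      have t1 : w + (j + b) - (w + j) = b := by omega
      have t2 : w + (j + b) + r - (w + j) = b + r := by omega
      have t3 : w + (j + b) + r - w = j + (b + r) := by omega
      have t4 : j + b + r = j + (b + r) := by omega
      rw [t1, t2, t3, t4, Nat.add_sub_cancel_left, Nat.add_sub_cancel_left]
      linear_combination (-1 : ℚ) ^ b * (q : ℚ) ^ (b.choose 2) *
        gaussianBinom_mul_gaussianBinom hq j b (b + r)
    rw [Finset.sum_congr rfl e3, ← Finset.mul_sum, sum_gaussianBinom_alternating hq]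
    rcases Nat.eq_zero_or_pos s with rfl | hs
    · simp
    · simp [hs.ne']
  rw [Finset.sum_congr rfl e']
  simp

/-! ### Counting linearly independent tuples -/

section Counting

open Module

variable {F V : Type*} [Field F] [AddCommGroup V] [Module F V] [Finite V]

/-- Linearly independent tuples whose span lies in `W` are linearly independent tuples of `W`. -/
def linearIndependentSpanLEEquiv (k : ℕ) (W : Submodule F V) :
    {b : {b : Fin k → V // LinearIndependent F b} // Submodule.span F (Set.range b.1) ≤ W} ≃
      {b : Fin k → W // LinearIndependent F b} where
  toFun b := ⟨fun i => ⟨b.1.1 i, b.2 (Submodule.subset_span ⟨i, rfl⟩)⟩,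
    LinearIndependent.of_comp W.subtype b.1.2⟩
  invFun b := ⟨⟨fun i => b.1 i, b.2.map' W.subtype W.ker_subtype⟩, by
    rw [Submodule.span_le]; rintro _ ⟨i, rfl⟩; exact (b.1 i).2⟩
  left_inv _ := rfl
  right_inv _ := rfl

/-- An isomorphism U ≅ U' extends to an automorphism of V, which carries the tuples for U to those
for U'. -/
theorem card_linearIndependent_le_span_congr (k : ℕ) {U U' : Submodule F V}
    (h : finrank F U = finrank F U') :
    Nat.card {s : {s : Fin k → V // LinearIndependent F s} //
      U ≤ Submodule.span F (Set.range s.1)} =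
    Nat.card {s : {s : Fin k → V // LinearIndependent F s} //
      U' ≤ Submodule.span F (Set.range s.1)} := by
  obtain ⟨g, hg⟩ := Submodule.exists_linearEquiv_restrict_eq (LinearEquiv.ofFinrankEq U U' h)
  have hU : U.map (g : V →ₗ[F] V) = U' := by
    ext x
    constructor
    · rintro ⟨y, hy, rfl⟩
      have := hg ⟨y, hy⟩
      simp only [LinearEquiv.coe_coe] at this ⊢
      rw [← this]
      exact Subtype.coe_prop _
    · intro hx
      refine ⟨(LinearEquiv.ofFinrankEq U U' h).symm ⟨x, hx⟩, Subtype.coe_prop _, ?_⟩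
      rw [LinearEquiv.coe_coe, ← hg, LinearEquiv.apply_symm_apply]
  refine Nat.card_congr (Equiv.subtypeEquiv (Equiv.subtypeEquiv
    (Equiv.arrowCongr (Equiv.refl _) g.toEquiv) fun s => ?_) fun s => ?_)
  · exact (LinearMap.linearIndependent_iff (g : V →ₗ[F] V) (v := s) g.ker).symm
  · change U ≤ Submodule.span F (Set.range s.1) ↔
      U' ≤ Submodule.span F (Set.range ((g : V →ₗ[F] V) ∘ s.1))
    rw [← hU, Set.range_comp, ← Submodule.map_span]
    exact (Submodule.map_le_map_iff_of_injective g.injective _ _).symm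

theorem card_linearIndependent_le_span_eq_zero {k : ℕ} {U : Submodule F V} (h : k < finrank F U) :
    Nat.card {s : {s : Fin k → V // LinearIndependent F s} //
      U ≤ Submodule.span F (Set.range s.1)} = 0 := by
  refine @Nat.card_of_isEmpty _ ⟨fun s => ?_⟩
  have h1 := Submodule.finrank_mono s.2
  rw [finrank_span_eq_card s.1.2, Fintype.card_fin] at h1
  omega

variable [Fintype F]

theorem card_linearIndependent_eq_qFalling (k : ℕ) :
    (Nat.card {s : Fin k → V // LinearIndependent F s} : ℚ) =
      qFalling (Fintype.card F) (finrank F V) k := by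
  rcases le_or_gt k (finrank F V) with hk | hk
  · rw [card_linearIndependent hk, qFalling, ← Fin.prod_univ_eq_prod_range
      (fun j => (Fintype.card F : ℚ) ^ finrank F V - (Fintype.card F : ℚ) ^ j)]
    push_cast
    refine Finset.prod_congr rfl fun i _ => ?_
    rw [Nat.cast_sub (Nat.pow_le_pow_right Fintype.card_pos (by omega))]
    push_cast
    rfl
  · rw [qFalling_eq_zero hk, Nat.cast_eq_zero]
    refine @Nat.card_of_isEmpty _ ⟨fun s => ?_⟩
    have := s.2.fintype_card_le_finrank
    simp at this
    omega

theorem card_linearIndependent_span_le (k : ℕ) (W : Submodule F V) :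
    (Nat.card {b : {b : Fin k → V // LinearIndependent F b} //
      Submodule.span F (Set.range b.1) ≤ W} : ℚ) =
      qFalling (Fintype.card F) (finrank F W) k := by
  rw [Nat.card_congr (linearIndependentSpanLEEquiv k W), card_linearIndependent_eq_qFalling]

/-- Double counting of pairs (s, b) of independent k- and u-tuples with span b ≤ span s, where u =
dim U. By the previous congruence, every b has as many s above it as U has. -/
theorem card_linearIndependent_le_span (k : ℕ) (U : Submodule F V) :
    (Nat.card {s : {s : Fin k → V // LinearIndependent F s} //
      U ≤ Submodule.span F (Set.range s.1)} : ℚ) *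
        qFalling (Fintype.card F) (finrank F V) (finrank F U) =
      qFalling (Fintype.card F) (finrank F V) k * qFalling (Fintype.card F) k (finrank F U) := by
  classical
  have := Fintype.ofFinite V
  set u := finrank F U
  let A := {s : Fin k → V // LinearIndependent F s}
  let B := {b : Fin u → V // LinearIndependent F b}
  let r : A → B → Prop := fun s b =>
    Submodule.span F (Set.range b.1) ≤ Submodule.span F (Set.range s.1)
  have h1 : ∀ a : A, ∑ b : B, (if r a b then (1 : ℚ) else 0) = qFalling (Fintype.card F) k u := by
    intro a
    have := card_linearIndependent_span_le u (Submodule.span F (Set.range a.1))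
    rw [finrank_span_eq_card a.2, Fintype.card_fin] at this
    rw [← this, Finset.sum_boole, Nat.card_eq_fintype_card, Fintype.card_subtype]
  have h2 : ∀ b : B, ∑ a : A, (if r a b then (1 : ℚ) else 0) =
      (Nat.card {s : A // U ≤ Submodule.span F (Set.range s.1)} : ℚ) := by
    intro b
    rw [card_linearIndependent_le_span_congr k (U := U)
      (U' := Submodule.span F (Set.range b.1)) (by simp [finrank_span_eq_card b.2, u]),
      Finset.sum_boole, Nat.card_eq_fintype_card, Fintype.card_subtype]
  have h3 := Finset.sum_comm (s := (Finset.univ : Finset A)) (t := (Finset.univ : Finset B))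
    (f := fun a b => if r a b then (1 : ℚ) else 0)
  rw [Finset.sum_congr rfl fun a _ => h1 a, Finset.sum_congr rfl fun b _ => h2 b,
    Finset.sum_const, Finset.sum_const, Finset.card_univ, Finset.card_univ,
    ← Nat.card_eq_fintype_card (α := A), ← Nat.card_eq_fintype_card (α := B), nsmul_eq_mul, nsmul_eq_mul,
    card_linearIndependent_eq_qFalling, card_linearIndependent_eq_qFalling] at h3
  rw [h3, mul_comm]

theorem card_linearIndependent_le_span_eq_gaussianBinom {k : ℕ} {U : Submodule F V}
    (h : finrank F U ≤ k) :
    (Nat.card {s : {s : Fin k → V // LinearIndependent F s} //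
      U ≤ Submodule.span F (Set.range s.1)} : ℚ) =
      qFalling (Fintype.card F) k k *
        gaussianBinom (Fintype.card F) (finrank F V - finrank F U) (k - finrank F U) := by
  have hU : finrank F U ≤ finrank F V := U.finrank_le
  have hq : 2 ≤ Fintype.card F := Fintype.one_lt_card
  have h1 := card_linearIndependent_le_span k U
  rw [qFalling_mul_qFalling hq hU h, mul_comm] at h1
  exact mul_left_cancel₀ (qFalling_ne_zero hq hU) h1

end Counting

/-! ### Character sums over matrices of given rank -/

section CharacterSums

open Module

variable {F : Type*} [Field F]

/-- A nonzero functional is onto F, so its composite with χ is a nontrivial character, whose sum is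
0. -/
theorem sum_addChar_linearMap {W : Type*} [AddCommGroup W] [Module F W] [Fintype W]
    {χ : AddChar F ℂ} (hχ : χ ≠ 1) (f : W →ₗ[F] F) [Decidable (f = 0)] :
    ∑ x, χ (f x) = if f = 0 then (Fintype.card W : ℂ) else 0 := by
  split_ifs with hf
  · simp [hf]
  · have h : χ.compAddMonoidHom f.toAddMonoidHom ≠ 1 := by
      intro h
      refine hχ (AddChar.ext _ _ fun a => ?_)
      obtain ⟨x, rfl⟩ := LinearMap.surjective hf a
      exact DFunLike.congr_fun h x
    exact AddChar.sum_eq_zero_of_ne_one h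

theorem Matrix.trace_mul_transpose_eq_sum_dotProduct {n m : ℕ}
    (X Y : Matrix (Fin n) (Fin m) F) :
    (X * Y.transpose).trace = ∑ j, X.col j ⬝ᵥ Y.col j := by
  simp only [Matrix.trace, Matrix.diag, Matrix.mul_apply, Matrix.transpose_apply, dotProduct,
    Matrix.col_apply]
  exact Finset.sum_comm

/-- The matrices whose columns lie in `W`, viewed as tuples of vectors of `W`. -/
def matrixColsEquiv {n : ℕ} (m : ℕ) (W : Submodule F (Fin n → F)) :
    {Y : Matrix (Fin n) (Fin m) F // Submodule.span F (Set.range Y.col) ≤ W} ≃ (Fin m → W) where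
  toFun Y j := ⟨Y.1.col j, Y.2 (Submodule.subset_span ⟨j, rfl⟩)⟩
  invFun c := ⟨Matrix.of fun i j => (c j).1 i, by
    rw [Submodule.span_le]; rintro _ ⟨j, rfl⟩; exact (c j).2⟩
  left_inv _ := rfl
  right_inv _ := rfl

theorem Matrix.finrank_ker_mulVecLin_transpose {n m : ℕ} (X : Matrix (Fin n) (Fin m) F) :
    finrank F (LinearMap.ker X.transpose.mulVecLin) = n - X.rank := by
  have h := LinearMap.finrank_range_add_finrank_ker X.transpose.mulVecLin
  have h' : finrank F (LinearMap.range X.transpose.mulVecLin) = X.rank := by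
    rw [← X.rank_transpose]; rfl
  rw [h'] at h
  simp at h
  omega

variable [Fintype F]

open Classical in
theorem sum_addChar_trace_cols_le {n m : ℕ} {χ : AddChar F ℂ} (hχ : χ ≠ 1)
    (X : Matrix (Fin n) (Fin m) F) (W : Submodule F (Fin n → F)) :
    ∑ Y : Matrix (Fin n) (Fin m) F, (if Submodule.span F (Set.range Y.col) ≤ W then
      χ ((X * Y.transpose).trace) else 0) =
      if W ≤ LinearMap.ker X.transpose.mulVecLin then
        (Fintype.card F : ℂ) ^ (m * finrank F W) else 0 := by
  let f : (Fin m → W) →ₗ[F] F :=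
    { toFun := fun c => ∑ j, X.col j ⬝ᵥ (c j).1
      map_add' := fun c d => by simp [Finset.sum_add_distrib]
      map_smul' := fun a c => by simp [Finset.mul_sum] }
  have hf : f = 0 ↔ W ≤ LinearMap.ker X.transpose.mulVecLin := by
    constructor
    · intro h w hw
      rw [LinearMap.mem_ker, Matrix.mulVecLin_apply]
      ext j
      have := LinearMap.congr_fun h (Pi.single j ⟨w, hw⟩)
      change ∑ i, X.col i ⬝ᵥ ((Pi.single j (⟨w, hw⟩ : W) : Fin m → W) i).1 = 0 at this
      rw [Finset.sum_eq_single j] at this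
      · simp only [Pi.single_eq_same] at this
        exact this
      · intro b _ hb; simp [hb]
      · simp
    · intro h
      refine LinearMap.ext fun c => ?_
      change ∑ j, X.col j ⬝ᵥ (c j).1 = 0
      refine Finset.sum_eq_zero fun j _ => ?_
      exact congrFun (h (c j).2) j
  rw [← Finset.sum_filter, ← Finset.sum_subtype_eq_sum_filter, Finset.subtype_univ,
    ← Equiv.sum_comp (matrixColsEquiv m W).symm]
  have e : ∀ c : Fin m → W, χ ((X * ((matrixColsEquiv m W).symm c).1.transpose).trace) =
      χ (f c) := by
    intro c
    rw [Matrix.trace_mul_transpose_eq_sum_dotProduct]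
    rfl
  rw [Finset.sum_congr rfl fun c _ => e c, sum_addChar_linearMap hχ]
  simp only [hf]
  congr 1
  rw [Fintype.card_fun, Fintype.card_fin, ← Nat.card_eq_fintype_card,
    Module.natCard_eq_pow_finrank (K := F), Nat.card_eq_fintype_card, mul_comm, pow_mul]
  push_cast
  rfl

open Classical in
/-- The sum of `χ (tr (X Yᵀ))` over the matrices `Y` of rank `u`. -/
noncomputable def rankCharSum {n m : ℕ} (χ : AddChar F ℂ) (X : Matrix (Fin n) (Fin m) F)
    (u : ℕ) : ℂ :=
  ∑ Y : Matrix (Fin n) (Fin m) F, if Y.rank = u then χ ((X * Y.transpose).trace) else 0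

/-- After exchanging the sums, each s contributes q^(mk) exactly when its span lies in ker Xᵀ, a
space of dimension n - rk X. -/
theorem sum_addChar_trace_mul_card {n m : ℕ} {χ : AddChar F ℂ} (hχ : χ ≠ 1)
    (X : Matrix (Fin n) (Fin m) F) (k : ℕ) :
    ∑ Y : Matrix (Fin n) (Fin m) F, χ ((X * Y.transpose).trace) *
      ((Nat.card {s : {s : Fin k → Fin n → F // LinearIndependent F s} //
        Submodule.span F (Set.range Y.col) ≤ Submodule.span F (Set.range s.1)} : ℚ) : ℂ) =
      (Fintype.card F : ℂ) ^ (m * k) * (qFalling (Fintype.card F) (n - X.rank) k : ℂ) := by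
  classical
  have h1 : ∀ Y : Matrix (Fin n) (Fin m) F, χ ((X * Y.transpose).trace) *
      ((Nat.card {s : {s : Fin k → Fin n → F // LinearIndependent F s} //
        Submodule.span F (Set.range Y.col) ≤ Submodule.span F (Set.range s.1)} : ℚ) : ℂ) =
      ∑ s : {s : Fin k → Fin n → F // LinearIndependent F s},
        if Submodule.span F (Set.range Y.col) ≤ Submodule.span F (Set.range s.1) then
          χ ((X * Y.transpose).trace) else 0 := by
    intro Y
    rw [← Finset.sum_filter, Finset.sum_const, nsmul_eq_mul, Nat.card_eq_fintype_card,
      Fintype.card_subtype, mul_comm]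
    push_cast
    rfl
  rw [Finset.sum_congr rfl fun Y _ => h1 Y, Finset.sum_comm]
  have h2 : ∀ s : {s : Fin k → Fin n → F // LinearIndependent F s},
      ∑ Y : Matrix (Fin n) (Fin m) F,
        (if Submodule.span F (Set.range Y.col) ≤ Submodule.span F (Set.range s.1) then
          χ ((X * Y.transpose).trace) else 0) =
      if Submodule.span F (Set.range s.1) ≤ LinearMap.ker X.transpose.mulVecLin then
        (Fintype.card F : ℂ) ^ (m * k) else 0 := by
    intro s
    rw [sum_addChar_trace_cols_le hχ, finrank_span_eq_card s.2, Fintype.card_fin]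
  rw [Finset.sum_congr rfl fun s _ => h2 s, ← Finset.sum_filter, Finset.sum_const, nsmul_eq_mul,
    mul_comm, ← X.finrank_ker_mulVecLin_transpose, ← card_linearIndependent_span_le,
    Nat.card_eq_fintype_card, Fintype.card_subtype]
  push_cast
  rfl

/-- Grouping the Y of the previous sum by rank: the number of tuples whose span contains the column
space depends only on its dimension. Dividing by the number of ordered bases of a k-space passes
from tuples to subspaces. -/
theorem sum_gaussianBinom_mul_rankCharSum {n m : ℕ} {χ : AddChar F ℂ} (hχ : χ ≠ 1)
    (X : Matrix (Fin n) (Fin m) F) (k : ℕ) :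
    ∑ u ∈ Finset.range (k + 1), (gaussianBinom (Fintype.card F) (n - u) (k - u) : ℂ) *
      rankCharSum χ X u =
      (Fintype.card F : ℂ) ^ (m * k) * (gaussianBinom (Fintype.card F) (n - X.rank) k : ℂ) := by
  classical
  have hk : (qFalling (Fintype.card F) k k : ℂ) ≠ 0 :=
    Rat.cast_ne_zero.2 (qFalling_ne_zero Fintype.one_lt_card le_rfl)
  have h := sum_addChar_trace_mul_card hχ X k
  rw [gaussianBinom_eq_div, Rat.cast_div, ← mul_div_assoc, ← h, eq_div_iff hk, Finset.sum_mul]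
  simp only [rankCharSum, Finset.mul_sum, Finset.sum_mul]
  rw [Finset.sum_comm]
  refine Finset.sum_congr rfl fun Y _ => ?_
  have hr : finrank F (Submodule.span F (Set.range Y.col)) = Y.rank :=
    Y.rank_eq_finrank_span_cols.symm
  rcases le_or_gt Y.rank k with hY | hY
  · rw [card_linearIndependent_le_span_eq_gaussianBinom (by rw [hr]; exact hY), hr,
      Finset.sum_eq_single Y.rank]
    · simp
      ring
    · intro b _ hb
      simp [hb.symm]
    · intro h'
      exact absurd (Finset.mem_range.2 (Nat.lt_succ_of_le hY)) h'
  · rw [card_linearIndependent_le_span_eq_zero (by rw [hr]; exact hY)]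
    rw [Finset.sum_eq_zero fun u hu => ?_]
    · simp
    · have : Y.rank ≠ u := by have := Finset.mem_range.1 hu; omega
      simp [this]

theorem rankCharSum_eq {n m : ℕ} {χ : AddChar F ℂ} (hχ : χ ≠ 1)
    (X : Matrix (Fin n) (Fin m) F) (u : ℕ) :
    rankCharSum χ X u = ∑ v ∈ Finset.range (u + 1), (-1 : ℂ) ^ (u - v) *
      (Fintype.card F : ℂ) ^ ((u - v).choose 2) *
      (gaussianBinom (Fintype.card F) (n - v) (u - v) : ℂ) *
      ((Fintype.card F : ℂ) ^ (m * v) *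
        (gaussianBinom (Fintype.card F) (n - X.rank) v : ℂ)) := by
  rcases le_or_gt u n with hu | hu
  · exact gaussianBinom_inversion Fintype.one_lt_card
      (fun k _ => sum_gaussianBinom_mul_rankCharSum hχ X k) hu
  -- For u > n no matrix has rank u. On the right one of the two Gaussian binomials vanishes, the
  -- choice depending on whether v ≤ n because of truncated subtraction.
  · rw [rankCharSum, Finset.sum_eq_zero, Finset.sum_eq_zero]
    · intro v hv
      have hv := Finset.mem_range.1 hv
      rcases le_or_gt v n with hvn | hvn
      · rw [gaussianBinom_eq_zero (a := n - v) (by omega)]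
        simp
      · rw [gaussianBinom_eq_zero (a := n - X.rank) (by omega)]
        simp
    · intro Y _
      have := Y.rank_le_height
      rw [if_neg (by omega)]

end CharacterSums

/-! ### The MacWilliams identity for rank lists -/

namespace SumRankSpace

section MacWilliams

variable {F : Type*} [Field F] [Fintype F] {t : ℕ} {n m : Fin t → ℕ}

open Classical in
theorem rankListDist_eq_sum (C : Submodule F (SumRankSpace F n m)) (u : Fin t → ℕ) :
    rankListDist C u = ∑ X : C, if (fun i => (X.1 i).rank) = u then 1 else 0 := by
  rw [rankListDist, ← Finset.sum_filter, ← Finset.card_eq_sum_ones, ← Fintype.card_subtype,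
    ← Nat.card_eq_fintype_card]
  refine Nat.card_congr ((Equiv.subtypeSubtypeEquivSubtypeInter (· ∈ C)
    (fun X : SumRankSpace F n m => ∀ i, (X i).rank = u i)).symm.trans ?_)
  exact Equiv.subtypeEquivRight fun X => funext_iff.symm

theorem support_rankListDist_subset (C : Submodule F (SumRankSpace F n m)) :
    {h : Fin t → ℕ | rankListDist C h ≠ 0} ⊆ Set.range fun (X : C) i => (X.1 i).rank := by
  classical
  intro h hh
  rw [Set.mem_ofPred_eq, rankListDist_eq_sum] at hh
  obtain ⟨X, -, hX⟩ := Finset.exists_ne_zero_of_sum_ne_zero hh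
  exact ⟨X, by by_contra hne; exact hX (if_neg hne)⟩

open Classical in
theorem finsum_rankListDist_mul (C : Submodule F (SumRankSpace F n m)) (g : (Fin t → ℕ) → ℚ) :
    ∑ᶠ h : Fin t → ℕ, (rankListDist C h : ℚ) * g h = ∑ X : C, g fun i => (X.1 i).rank := by
  rw [finsum_eq_sum_of_support_subset (s := Finset.univ.image fun (X : C) i => (X.1 i).rank)]
  · have h1 : ∀ h : Fin t → ℕ, (rankListDist C h : ℚ) * g h =
        ∑ X : C, if (fun i => (X.1 i).rank) = h then g fun i => (X.1 i).rank else 0 := by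
      intro h
      rw [rankListDist_eq_sum]
      push_cast
      rw [Finset.sum_mul]
      refine Finset.sum_congr rfl fun X _ => ?_
      split_ifs with hX
      · rw [hX, one_mul]
      · rw [zero_mul]
    rw [Finset.sum_congr rfl fun h _ => h1 h, Finset.sum_comm]
    refine Finset.sum_congr rfl fun X _ => ?_
    rw [Finset.sum_ite_eq, if_pos (Finset.mem_image_of_mem _ (Finset.mem_univ X))]
  · intro h hh
    have h0 : rankListDist C h ≠ 0 := fun h0 => hh (by simp [h0])
    obtain ⟨X, rfl⟩ := support_rankListDist_subset C h0
    exact Finset.mem_coe.2 (Finset.mem_image_of_mem _ (Finset.mem_univ X))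

open Classical in
theorem sum_addChar_traceProd {χ : AddChar F ℂ} (hχ : χ ≠ 1)
    (C : Submodule F (SumRankSpace F n m)) (Y : SumRankSpace F n m) :
    ∑ X : C, χ (traceProd X.1 Y) = if Y ∈ dual C then (Nat.card C : ℂ) else 0 := by
  let f : C →ₗ[F] F :=
    { toFun := fun X => traceProd X.1 Y
      map_add' := fun X Z => by simp [traceProd, Matrix.add_mul, Finset.sum_add_distrib]
      map_smul' := fun a X => by simp [traceProd, Finset.mul_sum] }
  have hf : f = 0 ↔ Y ∈ dual C :=
    ⟨fun h X hX => LinearMap.congr_fun h ⟨X, hX⟩, fun h => LinearMap.ext fun X => h X.1 X.2⟩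
  have := sum_addChar_linearMap hχ f
  rw [if_congr hf rfl rfl, ← Nat.card_eq_fintype_card] at this
  exact this

theorem prod_rankCharSum (χ : AddChar F ℂ) (X : SumRankSpace F n m) (u : Fin t → ℕ)
    [∀ Y : SumRankSpace F n m, Decidable ((fun i => (Y i).rank) = u)] :
    ∏ i, rankCharSum χ (X i) (u i) =
      ∑ Y : SumRankSpace F n m, if (fun i => (Y i).rank) = u then χ (traceProd X Y) else 0 := by
  classical
  simp only [rankCharSum]
  rw [Finset.prod_univ_sum, Fintype.piFinset_univ]
  refine Finset.sum_congr rfl fun Y _ => ?_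
  split_ifs with hY
  · have h1 := fun i => congrFun hY i
    simp only [h1, if_true, traceProd]
    exact (map_prod χ.toMonoidHom (fun i => Multiplicative.ofAdd
      ((X i * (Y i).transpose).trace)) Finset.univ).symm
  · obtain ⟨i, hi⟩ := Function.ne_iff.1 hY
    exact Finset.prod_eq_zero (Finset.mem_univ i) (if_neg hi)

/-- The coefficient of `W_h(C)` in the MacWilliams identity for `W_u` of the dual code. -/
def macWilliamsCoeff (q : ℕ) (n m u h : Fin t → ℕ) : ℚ :=
  ∑ v ∈ Finset.Iic u, (q : ℚ) ^ (∑ i, m i * v i) *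
    ∏ i, ((-1 : ℚ) ^ (u i - v i) * (q : ℚ) ^ ((u i - v i).choose 2) *
      gaussianBinom q (n i - h i) (v i) * gaussianBinom q (n i - v i) (u i - v i))

theorem prod_rankCharSum_eq_macWilliamsCoeff {χ : AddChar F ℂ} (hχ : χ ≠ 1)
    (X : SumRankSpace F n m) (u : Fin t → ℕ) :
    ∏ i, rankCharSum χ (X i) (u i) =
      (macWilliamsCoeff (Fintype.card F) n m u (fun i => (X i).rank) : ℂ) := by
  simp only [rankCharSum_eq hχ]
  rw [Finset.prod_univ_sum, macWilliamsCoeff, Rat.cast_sum]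
  have hs : Fintype.piFinset (fun i => Finset.range (u i + 1)) = Finset.Iic u := by
    ext v
    simp [Fintype.mem_piFinset, Pi.le_def]
  rw [hs]
  refine Finset.sum_congr rfl fun v _ => ?_
  rw [← Finset.prod_pow_eq_pow_sum, ← Finset.prod_mul_distrib, Rat.cast_prod]
  refine Finset.prod_congr rfl fun i _ => ?_
  push_cast
  ring

/-- Both sides evaluate the double sum of χ(`traceProd X Y`) over X ∈ C and Y of rank list u:
summing over X first detects the dual, summing over Y first gives the coefficients. -/
theorem card_mul_rankListDist_dual (C : Submodule F (SumRankSpace F n m)) (u : Fin t → ℕ) :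
    (Nat.card C : ℚ) * rankListDist (dual C) u =
      ∑ᶠ h : Fin t → ℕ,
        (rankListDist C h : ℚ) * macWilliamsCoeff (Fintype.card F) n m u h := by
  classical
  obtain ⟨χ, hχ⟩ := AddChar.exists_apply_ne_zero.2 (one_ne_zero (α := F))
  have hχ : χ ≠ 1 := fun h => hχ (by simp [h])
  rw [finsum_rankListDist_mul, ← Rat.cast_inj (α := ℂ), Rat.cast_sum]
  simp only [← prod_rankCharSum_eq_macWilliamsCoeff hχ, prod_rankCharSum]
  rw [Finset.sum_comm, rankListDist, Nat.card_eq_fintype_card (α := {Y // Y ∈ dual C ∧ _}),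
    Fintype.card_subtype, Finset.card_filter]
  push_cast
  rw [Finset.mul_sum]
  refine Finset.sum_congr rfl fun Y _ => ?_
  by_cases hY : (fun i => (Y i).rank) = u
  · simp only [if_true, sum_addChar_traceProd hχ, congrFun hY, implies_true, and_true]
    split_ifs <;> simp
  · have hY' : ¬ ∀ i, (Y i).rank = u i := fun h => hY (funext h)
    simp [hY, hY']

theorem finsum_rankListDist (C : Submodule F (SumRankSpace F n m)) :
    ∑ᶠ h : Fin t → ℕ, (rankListDist C h : ℚ) = Nat.card C := by
  classical
  have := finsum_rankListDist_mul C fun _ => 1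
  rw [Nat.card_eq_fintype_card]
  simpa using this

theorem rankListDist_dual_eq (C : Submodule F (SumRankSpace F n m)) (u : Fin t → ℕ) :
    (rankListDist (dual C) u : ℚ) = 1 / (Nat.card C : ℚ) *
      ∑ᶠ h : Fin t → ℕ,
        (rankListDist C h : ℚ) * macWilliamsCoeff (Fintype.card F) n m u h := by
  have hC : (Nat.card C : ℚ) ≠ 0 := Nat.cast_ne_zero.2 Nat.card_pos.ne'
  rw [← card_mul_rankListDist_dual]
  field_simp

/-- The factor 1/|C| is determined as well, since |C| is the total of the rank-list distribution. -/
theorem rankListDist_dual_congr {C₁ C₂ : Submodule F (SumRankSpace F n m)}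
    (h : ∀ r, rankListDist C₁ r = rankListDist C₂ r) (u : Fin t → ℕ) :
    rankListDist (dual C₁) u = rankListDist (dual C₂) u := by
  have hC : (Nat.card C₁ : ℚ) = Nat.card C₂ := by
    simp only [← finsum_rankListDist, h]
  rw [← Nat.cast_inj (R := ℚ), rankListDist_dual_eq, rankListDist_dual_eq, hC]
  simp only [h]

theorem finite_support_rankListDist (C : Submodule F (SumRankSpace F n m)) :
    {h : Fin t → ℕ | rankListDist C h ≠ 0}.Finite :=
  (Set.finite_range _).subset (support_rankListDist_subset C)

end MacWilliams

end SumRankSpace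

/-! ### The counterexample for sum-rank distributions -/

theorem Matrix.rank_eq_zero_iff {K : Type*} [Field K] {n m : ℕ}
    {M : Matrix (Fin n) (Fin m) K} : M.rank = 0 ↔ M = 0 := by
  refine ⟨fun h => ?_, fun h => by simp [h]⟩
  rw [Matrix.rank, Submodule.finrank_eq_zero, LinearMap.range_eq_bot] at h
  exact Matrix.toLin'.injective (by simpa [Matrix.toLin'_apply'] using h)

theorem Matrix.rank_fin_two {K : Type*} [Field K] [DecidableEq K]
    (M : Matrix (Fin 2) (Fin 2) K) :
    M.rank = if M = 0 then 0 else if M 0 0 * M 1 1 - M 0 1 * M 1 0 = 0 then 1 else 2 := by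
  split_ifs with h0 hd
  · rw [Matrix.rank_eq_zero_iff, h0]
  · have h1 : M.rank ≠ 0 := mt Matrix.rank_eq_zero_iff.1 h0
    -- The 2 × 2 adjugate only permutes entries up to sign, so it is nonzero with M. As M · adj M =
    -- 0, the two positive ranks add up to at most 2.
    have h2 : M.adjugate.rank ≠ 0 := by
      refine mt Matrix.rank_eq_zero_iff.1 fun h => h0 ?_
      rw [Matrix.adjugate_fin_two] at h
      have e := fun i j => congrFun (congrFun h i) j
      have e00 := e 0 0
      have e01 := e 0 1
      have e10 := e 1 0
      have e11 := e 1 1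
      simp at e00 e01 e10 e11
      ext i j
      fin_cases i <;> fin_cases j <;> simp [*]
    have h3 := Matrix.rank_add_rank_le_card_of_mul_eq_zero (A := M) (B := M.adjugate)
      (by rw [Matrix.mul_adjugate, Matrix.det_fin_two, hd, zero_smul])
    simp at h3
    omega
  · rw [Matrix.rank_of_det_ne_zero (by rwa [Matrix.det_fin_two])]
    simp

namespace SumRankSpace

section TwoBlocks

/-- Two blocks of `2 × 2` matrices over the field with two elements. -/
abbrev TwoBlocks : Type := SumRankSpace (ZMod 2) (fun _ : Fin 2 => 2) (fun _ : Fin 2 => 2)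

/-- The sum-rank of two `2 × 2` blocks, in a form that can be evaluated. -/
def TwoBlocks.computableSrk (X : TwoBlocks) : ℕ :=
  ∑ i, if X i = 0 then 0 else if X i 0 0 * X i 1 1 - X i 0 1 * X i 1 0 = 0 then 1 else 2

theorem TwoBlocks.srk_eq (X : TwoBlocks) : srk X = X.computableSrk :=
  Finset.sum_congr rfl fun i _ => Matrix.rank_fin_two (X i)

theorem mem_dual_span_singleton {F : Type*} [Field F] {t : ℕ} {n m : Fin t → ℕ}
    (A Y : SumRankSpace F n m) : Y ∈ dual (Submodule.span F {A}) ↔ traceProd A Y = 0 := by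
  refine ⟨fun h => h A (Submodule.mem_span_singleton_self A), fun h X hX => ?_⟩
  obtain ⟨a, rfl⟩ := Submodule.mem_span_singleton.1 hX
  have : traceProd (a • A) Y = a * traceProd A Y := by simp [traceProd, Finset.mul_sum]
  rw [this, h, mul_zero]

theorem TwoBlocks.sumRankDist_dual_span_singleton (A : TwoBlocks) (r : ℕ) :
    sumRankDist (dual (Submodule.span (ZMod 2) {A})) r =
      Fintype.card {Y : TwoBlocks // traceProd A Y = 0 ∧ Y.computableSrk = r} := by
  rw [sumRankDist, ← Nat.card_eq_fintype_card]
  exact Nat.card_congr (Equiv.subtypeEquivRight fun Y => by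
    rw [mem_dual_span_singleton, TwoBlocks.srk_eq])

theorem TwoBlocks.sumRankDist_span_singleton {A : TwoBlocks} (hA : A ≠ 0) (r : ℕ) :
    sumRankDist (Submodule.span (ZMod 2) {A}) r =
      (if 0 = r then 1 else 0) + if srk A = r then 1 else 0 := by
  classical
  have h0 : srk (0 : TwoBlocks) = 0 := by simp [srk]
  have hmem : ∀ X : TwoBlocks, X ∈ Submodule.span (ZMod 2) {A} ∧ srk X = r ↔
      X ∈ ({0, A} : Finset TwoBlocks).filter fun X => srk X = r := by
    intro X
    rw [Finset.mem_filter, Finset.mem_insert, Finset.mem_singleton,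
      Submodule.mem_span_singleton]
    refine and_congr_left fun _ => ⟨?_, ?_⟩
    · rintro ⟨a, rfl⟩
      fin_cases a
      · exact Or.inl (zero_smul _ A)
      · exact Or.inr (one_smul _ A)
    · rintro (rfl | rfl)
      · exact ⟨0, zero_smul _ A⟩
      · exact ⟨1, one_smul _ X⟩
  rw [sumRankDist, Nat.card_congr (Equiv.subtypeEquivRight hmem), Nat.card_eq_fintype_card,
    Fintype.card_coe, Finset.card_filter, Finset.sum_pair hA.symm, h0]

/-- A codeword of sum-rank two concentrated in the first block. -/
def TwoBlocks.concentratedWord : TwoBlocks := ![!![1, 0; 0, 1], 0]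

/-- A codeword of sum-rank two spread over both blocks. -/
def TwoBlocks.spreadWord : TwoBlocks := ![!![1, 0; 0, 0], !![1, 0; 0, 0]]

open TwoBlocks in
theorem exists_sumRankDist_eq_and_dual_ne :
    ∃ C₁ C₂ : Submodule (ZMod 2) TwoBlocks,
      (∀ r, sumRankDist C₁ r = sumRankDist C₂ r) ∧
        ∃ r, sumRankDist (dual C₁) r ≠ sumRankDist (dual C₂) r := by
  -- In sum-rank 1 the duals have 3 + 9 = 12 words (a trace-zero block of rank 1, or any rank-1
  -- second block) against 5 + 5 = 10 (a rank-1 block with zero corner entry, in either position).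
  refine ⟨Submodule.span _ {concentratedWord}, Submodule.span _ {spreadWord}, fun r => ?_, 1, ?_⟩
  · have h1 : concentratedWord ≠ 0 := by decide +kernel
    have h2 : spreadWord ≠ 0 := by decide +kernel
    have h3 : concentratedWord.computableSrk = spreadWord.computableSrk := by decide +kernel
    rw [sumRankDist_span_singleton h1, sumRankDist_span_singleton h2, srk_eq, srk_eq, h3]
  · rw [sumRankDist_dual_span_singleton, sumRankDist_dual_span_singleton]
    decide +kernel

end TwoBlocks

end SumRankSpace

open SumRankSpace in
/-- The sum over `h` ranges over all of `ℕ^t`; it has finite support, which is part of the claim.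
The truncated differences are harmless: `rankListDist C h = 0` if `h i > n i` for some `i`,
and `gaussianBinom q (n i - h i) (v i) = 0` if `v i > n i`. -/
theorem theorem5p4 :
    (∀ (F : Type*) [Field F] [Fintype F] (q : ℕ), Fintype.card F = q →
      ∀ (t : ℕ) (n m : Fin t → ℕ), 1 ≤ t → (∀ i, 1 ≤ n i) → (∀ i, n i ≤ m i) → Antitone m →
        -- the explicit identity
        (∀ (C : Submodule F (SumRankSpace F n m)) (u : Fin t → ℕ),
          {h : Fin t → ℕ | rankListDist C h ≠ 0}.Finite ∧
          (rankListDist (dual C) u : ℚ) =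
            1 / (Nat.card C : ℚ) *
              ∑ᶠ h : Fin t → ℕ, (rankListDist C h : ℚ) *
                ∑ v ∈ Finset.Iic u, (q : ℚ) ^ (∑ i, m i * v i) *
                  ∏ i, ((-1 : ℚ) ^ (u i - v i) * (q : ℚ) ^ ((u i - v i).choose 2) *
                    gaussianBinom q (n i - h i) (v i) *
                    gaussianBinom q (n i - v i) (u i - v i))) ∧
        -- the rank-list distribution determines that of the dual code
        (∀ C₁ C₂ : Submodule F (SumRankSpace F n m),
          (∀ h, rankListDist C₁ h = rankListDist C₂ h) →
            ∀ u, rankListDist (dual C₁) u = rankListDist (dual C₂) u)) ∧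
    -- the sum-rank distribution does not, already for two `2 × 2` blocks over `𝔽₂`
    (∃ C₁ C₂ : Submodule (ZMod 2) (SumRankSpace (ZMod 2) (fun _ : Fin 2 => 2) (fun _ : Fin 2 => 2)),
      (∀ r, sumRankDist C₁ r = sumRankDist C₂ r) ∧
        ∃ r, sumRankDist (dual C₁) r ≠ sumRankDist (dual C₂) r) := by
  refine ⟨?_, exists_sumRankDist_eq_and_dual_ne⟩
  rintro F _ _ q rfl t n m - - - -
  exact ⟨fun C u => ⟨finite_support_rankListDist C, rankListDist_dual_eq C u⟩,
    fun C₁ C₂ h u => rankListDist_dual_congr h u⟩
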